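/- Let $k\ge 1$ and $n_1,\dots,n_k\ge 0$ be integers ($\mathbb R^0=\{0\}$), $N=n_1+\dots+n_k$, let $\Omega_1\subset\mathbb R^{n_1}$ and $\Omega_2\subset\mathbb R^{n_2+\dots+n_k}$ be bounded open sets, and let $\Omega=\Omega_1\times\Omega_2\subset\mathbb R^N$; points of $\Omega$ are written $x=(x_1,\dots,x_k)$ with $x_i\in\mathbb R^{n_i}$. Let $p_1=1$, let $1<p_2\le\dots\le p_k<\infty$, let $q\in[1,\infty]$, and write $p'$ for the dual exponent of $p$ (with $1'=\infty$, $\infty'=1$). All spaces $\mathbb R^{n_i}$ carry the Euclidean norm, and $\mathcal M(\Omega;V)$ denotes the finite $V$-valued Radon measures on $\Omega$. Let $BV^{(p_i)}(\Omega)$ be the set of $u\in L^1(\Omega)$ whose distributional gradient is in $\mathcal M(\Omega;\mathbb R^N)$, whose distributional partial gradient $D_{x_1}u$ is in $\mathcal M(\Omega;\mathbb R^{n_1})$, with total variation measure $|D_{x_1}u|$, and whose distributional partial gradients $\nabla_{x_i}u$ are in $L^{p_i}(\Omega;\mathbb R^{n_i})$ for $i=2,\dots,k$. For $r\in[1,\infty]$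 let $X^{(p_i')}_r(\Omega)$ be the set of $\mathbf z=(\mathbf z_1,\dots,\mathbf z_k)$ with $\mathbf z_i\in L^{p_i'}(\Omega;\mathbb R^{n_i})$ for $i=1,\dots,k$ whose full distributional divergence $\operatorname{div}\mathbf z$ is in $L^r(\Omega)$. Assume that $$u\in BV^{(p_i)}(\Omega)\cap L^{\max(p_k,q)}(\Omega),\qquad \mathbf z\in X^{(p_i')}_{q'}(\Omega),$$ and define, for $\varphi\in C_c^\infty(\Omega)$, $$\langle(\mathbf z,Du),\varphi\rangle=-\int_\Omega u\,\varphi\,\operatorname{div}\mathbf z\,dx-\sum_{i=1}^k\int_\Omega u\,\mathbf z_i\cdot\nabla_{x_i}\varphi\,dx,$$ $$\langle(\mathbf z_1,D_{x_1}u),\varphi\rangle=\langle(\mathbf z,Du),\varphi\rangle-\sum_{i=2}^k\int_\Omega\varphi\,\mathbf z_i\cdot\nabla_{x_i}u\,dx.$$ Then $(\mathbf z,Du)$ and $(\mathbf z_1,D_{x_1}u)$ are finite signed Radon measures on $\Omega$. For every Borel set $B\subseteq\Omega$, $$\Big|\int_B(\mathbf z,Du)\Big|\le\|\mathbf z_1\|_\infty\int_B|D_{x_1}u|+\sum_{i=2}^k\|\mathbf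 z_i\|_{p_i'}\|\nabla_{x_i}u\|_{p_i},$$ $$\Big|\int_B(\mathbf z_1,D_{x_1}u)\Big|\le\|\mathbf z_1\|_\infty\int_B|D_{x_1}u|,$$ where the norms $\|\mathbf z_i\|_{p_i'}$ and $\|\nabla_{x_i}u\|_{p_i}$ are taken over $\Omega$. In particular $(\mathbf z_1,D_{x_1}u)$ is absolutely continuous with respect to $|D_{x_1}u|$. -/

import Mathlib

open MeasureTheory TopologicalSpace
open scoped ENNReal Distributions RealInnerProductSpace

noncomputable section

namespace Anzellotti

variable {m : ℕ} {n : Fin (m + 1) → ℕ}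

/-- `ℝ^N` with `N = n₁ + ... + n_k` and `k = m + 1`, whose coordinates are grouped in the blocks
`x₁, ..., x_k`. The block `x₁` has index `0 : Fin (m + 1)`. -/
abbrev Space (n : Fin (m + 1) → ℕ) : Type := EuclideanSpace ℝ (Σ i : Fin (m + 1), Fin (n i))

/-- `ℝ^{n_i}`. -/
abbrev Block (n : Fin (m + 1) → ℕ) (i : Fin (m + 1)) : Type := EuclideanSpace ℝ (Fin (n i))

/-- `ℝ^{n₂ + ... + n_k}`. -/
abbrev Rest (n : Fin (m + 1) → ℕ) : Type :=
  EuclideanSpace ℝ (Σ i : Fin m, Fin (n i.succ))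

/-- The block `x₁` of a point `x`. -/
def firstBlock (x : Space n) : Block n 0 := WithLp.toLp 2 fun j => x ⟨0, j⟩

/-- The blocks `(x₂, ..., x_k)` of a point `x`. -/
def restBlocks (x : Space n) : Rest n := WithLp.toLp 2 fun s => x ⟨s.1.succ, s.2⟩

theorem continuous_firstBlock : Continuous (firstBlock (n := n)) := by
  unfold firstBlock; fun_prop

theorem continuous_restBlocks : Continuous (restBlocks (n := n)) := by
  unfold restBlocks; fun_prop

/-- The product `Ω₁ × Ω₂` as an open subset of `ℝ^N`. -/
def prodDomain (Ω₁ : Opens (Block n 0)) (Ω₂ : Opens (Rest n)) : Opens (Space n) where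
  carrier := {x | firstBlock x ∈ Ω₁ ∧ restBlocks x ∈ Ω₂}
  is_open' := (Ω₁.isOpen.preimage continuous_firstBlock).inter
    (Ω₂.isOpen.preimage continuous_restBlocks)

/-- The standard basis vector of `ℝ^N` in the direction of the `j`-th coordinate of `x_i`. -/
def basisVec (i : Fin (m + 1)) (j : Fin (n i)) : Space n := EuclideanSpace.single ⟨i, j⟩ 1

/-- `∇_{x_i} φ` for a smooth function `φ`. -/
def gradBlock (i : Fin (m + 1)) (φ : Space n → ℝ) (x : Space n) : Block n i :=
  WithLp.toLp 2 fun j => fderiv ℝ φ x (basisVec i j)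

/-- `div_{x_i} Φ` for a smooth vector field `Φ` with values in `ℝ^{n_i}`. -/
def divBlock (i : Fin (m + 1)) (Φ : Space n → Block n i) (x : Space n) : ℝ :=
  ∑ j, fderiv ℝ Φ x (basisVec i j) j

/-- `div Φ` for a smooth vector field `Φ` with values in `ℝ^N`. -/
def divFull (Φ : Space n → Space n) (x : Space n) : ℝ :=
  ∑ s, fderiv ℝ Φ x (EuclideanSpace.single s 1) s

variable (Ω : Opens (Space n))

/-- `μ` is a finite Radon measure on `Ω` with values in `V` (a Euclidean space), i.e. an element
of `𝓜(Ω; V)`; it is regarded as a measure on `ℝ^N` that is concentrated on `Ω`. -/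
structure IsFiniteRadonOn {V : Type} [NormedAddCommGroup V]
    (μ : VectorMeasure (Space n) V) : Prop where
  concentrated : μ.restrict Ω = μ
  finite_variation : μ.variation Set.univ < ∞

/-- The distributional gradient `Du` is the measure `μ`. -/
structure IsDistribGrad (u : Space n → ℝ) (μ : VectorMeasure (Space n) (Space n)) : Prop where
  radon : IsFiniteRadonOn Ω μ
  eq : ∀ Φ : 𝓓(Ω, Space n),
    ∫ x in Ω, u x * divFull Φ x = - ∫ᵛ x, Φ x ∂[innerSL ℝ; μ]

/-- The distributional partial gradient `D_{x_i} u` is the measure `μ`. -/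
structure IsDistribGradBlock (i : Fin (m + 1)) (u : Space n → ℝ)
    (μ : VectorMeasure (Space n) (Block n i)) : Prop where
  radon : IsFiniteRadonOn Ω μ
  eq : ∀ Φ : 𝓓(Ω, Block n i),
    ∫ x in Ω, u x * divBlock i Φ x = - ∫ᵛ x, Φ x ∂[innerSL ℝ; μ]

/-- The distributional partial gradient of `u` in the direction `x_i` is the function `G`. -/
structure IsWeakGradBlock (i : Fin (m + 1)) (u : Space n → ℝ) (G : Space n → Block n i) :
    Prop where
  locallyIntegrable : LocallyIntegrableOn G Ω
  eq : ∀ Φ : 𝓓(Ω, Block n i),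
    ∫ x in Ω, u x * divBlock i Φ x = - ∫ x in Ω, ⟪Φ x, G x⟫

/-- The distributional divergence of `z = (z₁, ..., z_k)` is the function `g`. -/
structure IsWeakDiv (z : ∀ i, Space n → Block n i) (g : Space n → ℝ) : Prop where
  locallyIntegrable : LocallyIntegrableOn g Ω
  eq : ∀ φ : 𝓓(Ω, ℝ),
    ∫ x in Ω, g x * φ x = - ∑ i, ∫ x in Ω, ⟪z i x, gradBlock i φ x⟫

/-- `D_{x_i} u`, if it is a finite Radon measure. -/
def distribGradBlock (i : Fin (m + 1)) (u : Space n → ℝ) : VectorMeasure (Space n) (Block n i) :=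
  Classical.epsilon (IsDistribGradBlock Ω i u)

/-- `∇_{x_i} u`, if it is a locally integrable function (unique up to null sets). -/
def weakGradBlock (i : Fin (m + 1)) (u : Space n → ℝ) : Space n → Block n i :=
  Classical.epsilon (IsWeakGradBlock Ω i u)

/-- `div z`, if it is a locally integrable function (unique up to null sets). -/
def weakDiv (z : ∀ i, Space n → Block n i) : Space n → ℝ :=
  Classical.epsilon (IsWeakDiv Ω z)

/-- `u ∈ BV(Ω)`. -/
def MemBV (u : Space n → ℝ) : Prop :=
  MemLp u 1 (volume.restrict Ω) ∧ ∃ μ, IsDistribGrad Ω u μ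

/-- `u ∈ BV^{(p_i)}(Ω)`. -/
structure MemAnisoBV (p : Fin (m + 1) → ℝ≥0∞) (u : Space n → ℝ) : Prop where
  memBV : MemBV Ω u
  first : ∃ μ, IsDistribGradBlock Ω 0 u μ
  rest : ∀ i : Fin m, ∃ G, IsWeakGradBlock Ω i.succ u G ∧
    MemLp G (p i.succ) (volume.restrict Ω)

/-- `z ∈ X^{(s_i)}_r(Ω)`: the component `z_i` is in `L^{s_i}(Ω; ℝ^{n_i})` and `div z` is in
`L^r(Ω)`. -/
structure MemX (s : Fin (m + 1) → ℝ≥0∞) (r : ℝ≥0∞) (z : ∀ i, Space n → Block n i) : Prop where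
  memLp : ∀ i, MemLp (z i) (s i) (volume.restrict Ω)
  div : ∃ g, IsWeakDiv Ω z g ∧ MemLp g r (volume.restrict Ω)

/-- The pairing `(z, Du)` as a functional on `C_c^∞(Ω)`. -/
def pairing (z : ∀ i, Space n → Block n i) (u : Space n → ℝ) (φ : 𝓓(Ω, ℝ)) : ℝ :=
  - (∫ x in Ω, u x * φ x * weakDiv Ω z x)
    - ∑ i, ∫ x in Ω, u x * ⟪z i x, gradBlock i φ x⟫

/-- The pairing `(z₁, D_{x₁} u)` as a functional on `C_c^∞(Ω)`. -/
def firstPairing (z : ∀ i, Space n → Block n i) (u : Space n → ℝ) (φ : 𝓓(Ω, ℝ)) : ℝ :=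
  pairing Ω z u φ
    - ∑ i : Fin m, ∫ x in Ω, φ x * ⟪z i.succ x, weakGradBlock Ω i.succ u x⟫

/-- The functional `T` on `C_c^∞(Ω)` is (integration against) the finite signed Radon measure
`ν` on `Ω`. -/
structure IsRepresentedBy (T : 𝓓(Ω, ℝ) → ℝ) (ν : SignedMeasure (Space n)) : Prop where
  radon : IsFiniteRadonOn Ω ν
  eq : ∀ φ : 𝓓(Ω, ℝ), T φ = ∫ᵛ x, φ x ∂•ν

end Anzellotti

end

/-! Let `u_ε` be the mollification of `u` extended by zero. Testing `div z` with `u_ε φ` gives the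
product rule `IsWeakDiv.pairing_contDiff`, which is the definition of `(z, Du)` with `u_ε` in place
of `u`. As `ε → 0` every term without a derivative of `u_ε` converges, and so do the terms `∫ φ z_i
· ∇_{x_i} u_ε` with `i ≥ 2`, because on the support of `φ` the gradient `∇_{x_i} u_ε` is the
mollification of an `L^{p_i}` function. Hence `⟨(z₁, D_{x₁}u), φ⟩` is the limit of `∫ φ z₁ · ∇_{x₁}
u_ε` (`tendsto_integral_inner_gradBlock_mollify`).

An exponent may be infinite, and then mollifications need not converge in norm. Only integrals
against a function of the dual space are needed, and there the translation can be moved to whichever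
factor has finite exponent (`continuous_integral_inner_sub`).

Since `|∇_{x₁} u_ε|` is at most the mollification of `|D_{x₁}u|`, the limit is bounded by `‖z₁‖_∞ ∫
|φ| d|D_{x₁}u|` (`abs_firstPairing_le`). A functional with such a bound has a density with respect
to `|D_{x₁}u|` (`exists_density_of_abs_le_integral`), which gives `(z₁, D_{x₁}u)` with its bound and
absolute continuity. Adding the functions `z_i · ∇_{x_i} u`, which are integrable by Hölder, gives
`(z, Du)`. -/

/-! ### Translation and mollification in the duality of `L^p` and `L^{p'}` -/

open Filter Topology ContinuousLinearMap in
/-- Translation is continuous for the pairing of `L^p` and `L^{p'}`, if `p < ∞`. -/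
theorem continuous_integral_inner_sub_of_ne_top {E F : Type*} [NormedAddCommGroup E]
    [NormedSpace ℝ E] [FiniteDimensional ℝ E] [MeasurableSpace E] [BorelSpace E]
    [NormedAddCommGroup F] [InnerProductSpace ℝ F] {μ : Measure E} [μ.IsAddHaarMeasure]
    {p q : ℝ≥0∞} [p.HolderConjugate q] (hp : q ≠ ∞) {w u : E → F}
    (hw : MemLp w p μ) (hu : MemLp u q μ) : Continuous fun h => ∫ x, ⟪w x, u (x - h)⟫ ∂μ := by
  have : Fact (1 ≤ p) := ⟨ENNReal.HolderConjugate.one_le p q⟩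
  have : Fact (1 ≤ q) := ⟨ENNReal.HolderConjugate.one_le q p⟩
  let g : E → C(E, E) := fun h => ⟨fun x => x - h, by fun_prop⟩
  have hg : Continuous g :=
    ContinuousMap.continuous_of_continuous_uncurry _ (continuous_snd.sub continuous_fst)
  have hgm : ∀ h, MeasurePreserving (g h) μ μ := fun h => measurePreserving_sub_right μ h
  -- Translation is norm continuous in `L^q` because `q` is finite.
  have hc : Continuous fun h => Lp.compMeasurePreserving (g h) (hgm h) (hu.toLp u) :=
    continuous_const.compMeasurePreservingLp hg hgm hp
  refine (((innerSL ℝ).lpPairing μ p q (hw.toLp w)).continuous.comp hc).congr fun h => ?_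
  rw [Function.comp_apply, lpPairing_eq_integral]
  refine integral_congr_ae ?_
  rw [Lp.toLp_compMeasurePreserving hu (hgm h)]
  filter_upwards [hw.coeFn_toLp, (hu.comp_measurePreserving (hgm h)).coeFn_toLp] with x h1 h2
  rw [h1, h2]; rfl

/-- Translation is continuous for the pairing of `L^p` and `L^{p'}`. -/
theorem continuous_integral_inner_sub {E F : Type*} [NormedAddCommGroup E]
    [NormedSpace ℝ E] [FiniteDimensional ℝ E] [MeasurableSpace E] [BorelSpace E]
    [NormedAddCommGroup F] [InnerProductSpace ℝ F] {μ : Measure E} [μ.IsAddHaarMeasure]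
    {p q : ℝ≥0∞} [p.HolderConjugate q] {w u : E → F}
    (hw : MemLp w p μ) (hu : MemLp u q μ) : Continuous fun h => ∫ x, ⟪w x, u (x - h)⟫ ∂μ := by
  by_cases hq : q = ∞
  · have hp : p ≠ ∞ := by
      rintro rfl
      have := ENNReal.HolderConjugate.inv_add_inv_eq_one ∞ q
      simp [hq] at this
    -- By translation invariance the shift of `u` by `h` becomes a shift of `w` by `-h`, and `w` has
    -- finite exponent.
    have h := (continuous_integral_inner_sub_of_ne_top hp hu hw).comp continuous_neg
    refine h.congr fun y => ?_
    rw [Function.comp_apply, ← integral_sub_right_eq_self _ y]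
    simp [real_inner_comm]
  · exact continuous_integral_inner_sub_of_ne_top hq hw hu

-- Fubini: convergence of mollifications reduces to continuity, at `h = 0`, of the pairing with a
-- translate.
open Filter Topology Convolution ContinuousLinearMap in
theorem integral_inner_convolution {E F : Type*} [NormedAddCommGroup E]
    [NormedSpace ℝ E] [FiniteDimensional ℝ E] [MeasurableSpace E] [BorelSpace E]
    [NormedAddCommGroup F] [InnerProductSpace ℝ F] [CompleteSpace F] {μ : Measure E}
    [μ.IsAddHaarMeasure] {p q : ℝ≥0∞} [p.HolderConjugate q] {w u : E → F}
    (hw : MemLp w p μ) (hu : MemLp u q μ) {η : E → ℝ} (hη : Continuous η)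
    (hηc : HasCompactSupport η) :
    ∫ x, ⟪w x, (η ⋆[lsmul ℝ ℝ, μ] u) x⟫ ∂μ =
      ∫ h, η h * ∫ x, ⟪w x, u (x - h)⟫ ∂μ ∂μ := by
  have h1q : 1 ≤ q := ENNReal.HolderConjugate.one_le q p
  have hul : LocallyIntegrable u μ := hu.locallyIntegrable h1q
  have hsub : ∀ h, MemLp (fun x => u (x - h)) q μ := fun h =>
    hu.comp_measurePreserving (measurePreserving_sub_right μ h)
  have hint : ∀ h, Integrable (fun x => ⟪w x, u (x - h)⟫) μ := fun h =>
    memLp_one_iff_integrable.1 ((innerSL ℝ).memLp_of_bilin 1 hw (hsub h))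
  have hmeas : AEStronglyMeasurable (fun z : E × E => η z.1 * ⟪w z.2, u (z.2 - z.1)⟫)
      (μ.prod μ) := by
    refine (hη.comp continuous_fst).aestronglyMeasurable.mul ?_
    refine hw.1.comp_snd.inner ?_
    have := hu.1.comp_quasiMeasurePreserving (quasiMeasurePreserving_sub_of_right_invariant μ μ)
    exact this.comp_quasiMeasurePreserving
      (Measure.measurePreserving_swap (μ := μ) (ν := μ)).quasiMeasurePreserving
  have hprod : Integrable (fun z : E × E => η z.1 * ⟪w z.2, u (z.2 - z.1)⟫) (μ.prod μ) := by
    rw [integrable_prod_iff hmeas]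
    refine ⟨Eventually.of_forall fun h => (hint h).const_mul (η h), ?_⟩
    -- Hölder bounds the inner integral by a constant, since translates have the same norm.
    refine Integrable.mono' (g := fun h => ‖η h‖ *
      ((eLpNorm w p μ).toReal * (eLpNorm u q μ).toReal)) ?_ hmeas.norm.integral_prod_right' ?_
    · exact (hη.integrable_of_hasCompactSupport hηc).norm.mul_const _
    · refine Eventually.of_forall fun h => ?_
      rw [Real.norm_of_nonneg (by positivity)]
      simp_rw [norm_mul]
      rw [integral_const_mul]
      refine mul_le_mul_of_nonneg_left ?_ (norm_nonneg _)
      rw [integral_norm_eq_lintegral_enorm (hint h).1, ← ENNReal.toReal_mul]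
      refine ENNReal.toReal_mono (ENNReal.mul_ne_top hw.2.ne hu.2.ne) ?_
      rw [← eLpNorm_one_eq_lintegral_enorm]
      refine (eLpNorm_le_eLpNorm_mul_eLpNorm_of_nnnorm (p := p) (q := q) (r := 1) hw.1 (hsub h).1
        (fun a b => ⟪a, b⟫) 1 (Eventually.of_forall fun x => ?_)).trans_eq ?_
      · rw [one_mul]; exact nnnorm_inner_le_nnnorm _ _
      · rw [ENNReal.coe_one, one_mul]
        congr 1
        exact eLpNorm_comp_measurePreserving hu.1 (measurePreserving_sub_right μ h)
  calc _ = ∫ x, ∫ h, η h * ⟪w x, u (x - h)⟫ ∂μ ∂μ := by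
        refine integral_congr_ae (Eventually.of_forall fun x => ?_)
        simp only [convolution_lsmul]
        have hc : Integrable (fun t => η t • u (x - t)) μ :=
          hηc.convolutionExists_left (lsmul ℝ ℝ) hη hul x
        rw [← integral_inner hc]
        simp_rw [inner_smul_right]
    _ = ∫ h, ∫ x, η h * ⟪w x, u (x - h)⟫ ∂μ ∂μ := (integral_integral_swap hprod).symm
    _ = _ := by simp_rw [integral_const_mul]

open Filter Topology Convolution ContinuousLinearMap in
/-- Mollifications converge for the pairing of `L^p` and `L^{p'}`, also for `p = ∞`. -/
theorem tendsto_integral_inner_convolution {E F : Type*} [NormedAddCommGroup E]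
    [NormedSpace ℝ E] [FiniteDimensional ℝ E] [MeasurableSpace E] [BorelSpace E]
    [NormedAddCommGroup F] [InnerProductSpace ℝ F] [CompleteSpace F] {μ : Measure E}
    [μ.IsAddHaarMeasure] {p q : ℝ≥0∞} [p.HolderConjugate q] {w u : E → F}
    (hw : MemLp w p μ) (hu : MemLp u q μ) {ι : Type*} {l : Filter ι}
    {η : ι → ContDiffBump (0 : E)} (hη : Tendsto (fun i => (η i).rOut) l (𝓝 0)) :
    Tendsto (fun i => ∫ x, ⟪w x, ((η i).normed μ ⋆[lsmul ℝ ℝ, μ] u) x⟫ ∂μ) l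
      (𝓝 (∫ x, ⟪w x, u x⟫ ∂μ)) := by
  -- The composition with negation cancels the sign in the argument `0 - h` of the convolution.
  have h := ContDiffBump.convolution_tendsto_right_of_continuous (μ := μ) hη
    ((continuous_integral_inner_sub hw hu).comp continuous_neg) 0
  simp only [Function.comp_apply, neg_zero, sub_zero] at h
  refine h.congr fun i => ?_
  rw [integral_inner_convolution hw hu (η i).continuous_normed (η i).hasCompactSupport_normed,
    convolution_lsmul]
  simp

/-! ### Functionals bounded by an `L¹` norm, and signed measures with density -/

/-- A linear functional on a space of square integrable functions that is bounded by `C` times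
the `L¹` norm has a density whose set integrals are bounded by `C` times the measure. -/
theorem exists_density_of_abs_le_integral {X V : Type*} [MeasurableSpace X] {μ : Measure X}
    [IsFiniteMeasure μ] [AddCommGroup V] [Module ℝ V] (T : V →ₗ[ℝ] ℝ) (J : V →ₗ[ℝ] (X → ℝ))
    (hJ : ∀ v, MemLp (J v) 2 μ) {C : ℝ} (hC : 0 ≤ C) (hT : ∀ v, |T v| ≤ C * ∫ x, |J v x| ∂μ) :
    ∃ g : X → ℝ, Integrable g μ ∧ (∀ v, T v = ∫ x, J v x * g x ∂μ) ∧
      ∀ B, MeasurableSet B → |∫ x in B, g x ∂μ| ≤ C * μ.real B := by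
  have hJ1 : ∀ v, MemLp (J v) 1 μ := fun v => (hJ v).mono_exponent one_le_two
  let Φ : V →ₗ[ℝ] Lp ℝ 1 μ :=
    { toFun := fun v => (hJ1 v).toLp (J v)
      map_add' := fun v w => by
        rw [← MemLp.toLp_add]; exact MemLp.toLp_congr _ _ (by simp)
      map_smul' := fun c v => by
        rw [RingHom.id_apply, ← MemLp.toLp_const_smul]; exact MemLp.toLp_congr _ _ (by simp) }
  have hnorm : ∀ v, ‖Φ v‖ = ∫ x, |J v x| ∂μ := fun v => by
    rw [L1.norm_eq_integral_norm]
    refine integral_congr_ae ?_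
    filter_upwards [(hJ1 v).coeFn_toLp] with x hx
    change ‖((hJ1 v).toLp (J v)) x‖ = _
    rw [hx, Real.norm_eq_abs]
  -- The bound makes `T v` depend only on the `L¹` class of `J v`, so `T` descends to a subspace of
  -- `L¹`.
  have hker : LinearMap.ker Φ ≤ LinearMap.ker T := fun v hv => by
    rw [LinearMap.mem_ker] at hv ⊢
    have := hT v
    rw [← hnorm, hv, norm_zero, mul_zero] at this
    exact abs_nonpos_iff.1 this
  let T₀ : LinearMap.range Φ →ₗ[ℝ] ℝ :=
    (LinearMap.ker Φ).liftQ T hker ∘ₗ Φ.quotKerEquivRange.symm.toLinearMap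
  have hT₀ : ∀ v, T₀ ⟨Φ v, LinearMap.mem_range_self Φ v⟩ = T v := fun v => by
    change (LinearMap.ker Φ).liftQ T hker (Φ.quotKerEquivRange.symm _) = _
    rw [Φ.quotKerEquivRange_symm_apply_image v (LinearMap.mem_range_self Φ v)]
    rfl
  have hT₀C : ∀ y, ‖T₀ y‖ ≤ C * ‖y‖ := by
    rintro ⟨_, v, rfl⟩
    rw [hT₀, Real.norm_eq_abs]
    exact (hT v).trans_eq (by rw [← hnorm]; rfl)
  -- Hahn–Banach, with the same constant on all of `L¹`, so that indicators can be inserted later.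
  obtain ⟨f, hf, hfn⟩ := exists_extension_norm_eq _ (T₀.mkContinuous C hT₀C)
  have hfC : ∀ y, |f y| ≤ C * ‖y‖ := fun y => by
    refine (f.le_opNorm y).trans (mul_le_mul_of_nonneg_right ?_ (norm_nonneg _))
    rw [hfn]
    exact LinearMap.mkContinuous_norm_le _ hC _
  have hmono : ∀ h : Lp ℝ 2 μ, MemLp h 1 μ := fun h => (Lp.memLp h).mono_exponent one_le_two
  let ι : Lp ℝ 2 μ →ₗ[ℝ] Lp ℝ 1 μ :=
    { toFun := fun h => (hmono h).toLp h
      map_add' := fun v w => by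
        rw [← MemLp.toLp_add]; exact MemLp.toLp_congr _ _ (Lp.coeFn_add v w)
      map_smul' := fun c v => by
        rw [RingHom.id_apply, ← MemLp.toLp_const_smul]
        exact MemLp.toLp_congr _ _ (Lp.coeFn_smul c v) }
  have hι : ∀ h (hh : MemLp h 2 μ), ι (hh.toLp h) = (hh.mono_exponent one_le_two).toLp h :=
    fun h hh => MemLp.toLp_congr (hmono _) _ hh.coeFn_toLp
  -- The norm of the inclusion of `L²` in `L¹`, finite because `μ` is.
  let K : ℝ := (μ Set.univ ^ ((1 : ℝ) / 1 - 1 / 2)).toReal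
  have hιK : ∀ h, ‖ι h‖ ≤ K * ‖h‖ := fun h => by
    change ‖(hmono h).toLp h‖ ≤ _
    rw [Lp.norm_toLp, Lp.norm_def, mul_comm, ← ENNReal.toReal_mul]
    refine ENNReal.toReal_mono ?_ ?_
    · exact ENNReal.mul_ne_top (Lp.eLpNorm_ne_top h)
        (ENNReal.rpow_ne_top_of_nonneg (by norm_num) (measure_ne_top _ _))
    · simpa using eLpNorm_le_eLpNorm_mul_rpow_measure_univ (p := 1) (q := 2) one_le_two
        (Lp.aestronglyMeasurable h)
  let f₂ : Lp ℝ 2 μ →L[ℝ] ℝ := f ∘L ι.mkContinuous K hιK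
  -- Restricting to the Hilbert space `L²` gives a density by the Riesz theorem, without the dual of
  -- `L¹`.
  let G : Lp ℝ 2 μ := (InnerProductSpace.toDual ℝ (Lp ℝ 2 μ)).symm f₂
  have hG : ∀ h (hh : MemLp h 2 μ),
      f ((hh.mono_exponent one_le_two).toLp h) = ∫ x, h x * G x ∂μ := fun h hh => by
    have h1 : inner ℝ G (hh.toLp h) = f₂ (hh.toLp h) := InnerProductSpace.toDual_symm_apply
    have h2 : f₂ (hh.toLp h) = f (ι (hh.toLp h)) := rfl
    rw [← hι h hh, ← h2, ← h1, L2.inner_def]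
    refine integral_congr_ae ?_
    filter_upwards [hh.coeFn_toLp] with x hx
    rw [hx]; rfl
  refine ⟨G, memLp_one_iff_integrable.1 (hmono G), fun v => ?_, fun B hB => ?_⟩
  · rw [← hG _ (hJ v), ← hT₀ v]
    exact (hf ⟨Φ v, LinearMap.mem_range_self Φ v⟩).symm
  -- The extension at the indicator of `B` is at most `C` times its `L¹` norm, which is `μ.real B`.
  · have h1 : MemLp (B.indicator fun _ => (1 : ℝ)) 2 μ := memLp_indicator_const 2 hB 1 (by simp)
    have h2 := hG _ h1
    have h3 : ∫ x, B.indicator (fun _ => (1 : ℝ)) x * G x ∂μ = ∫ x in B, G x ∂μ := by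
      rw [← integral_indicator hB]
      congr 1 with x
      by_cases hx : x ∈ B <;> simp [hx]
    rw [← h3, ← h2]
    refine (hfC _).trans_eq ?_
    rw [Lp.norm_toLp, eLpNorm_one_eq_lintegral_enorm]
    congr 1
    rw [Measure.real]
    congr 1
    rw [← lintegral_indicator_one hB]
    congr 1 with x
    by_cases hx : x ∈ B <;> simp [hx]

/-- Splitting `g` into positive and negative parts reduces the vector integral to integrals against
two finite positive measures. -/
theorem integral_withDensityᵥ {X : Type*} [MeasurableSpace X] {μ : Measure X} {φ g : X → ℝ}
    (hg : Integrable g μ) (hφ : Measurable φ) {M : ℝ} (hM : ∀ x, ‖φ x‖ ≤ M) :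
    ∫ᵛ x, φ x ∂•(μ.withDensityᵥ g) = ∫ x, φ x * g x ∂μ := by
  have hfin : ∀ {f : X → ℝ}, Integrable f μ →
      IsFiniteMeasure (μ.withDensity fun x => ENNReal.ofReal (f x)) :=
    fun hf => isFiniteMeasure_withDensity_ofReal hf.2
  have := hfin hg
  have := hfin hg.neg
  have hint : ∀ (ρ : Measure X) [IsFiniteMeasure ρ], ρ.toSignedMeasure.Integrable φ := fun ρ _ => by
    rw [VectorMeasure.Integrable, Measure.variation_toSignedMeasure]
    exact Integrable.of_bound hφ.aestronglyMeasurable M (Filter.Eventually.of_forall hM)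
  have hden : ∀ {f : X → ℝ}, Integrable f μ →
      ∫ x, φ x ∂(μ.withDensity fun x => ENNReal.ofReal (f x)) =
        ∫ x, φ x * max (f x) 0 ∂μ := fun hf => by
    rw [integral_withDensity_eq_integral_toReal_smul₀ hf.1.aemeasurable.ennreal_ofReal
      (Filter.Eventually.of_forall fun _ => ENNReal.ofReal_lt_top)]
    simp_rw [ENNReal.toReal_ofReal', smul_eq_mul, mul_comm]
  have hint2 : ∀ {f : X → ℝ}, Integrable f μ → Integrable (fun x => φ x * max (f x) 0) μ :=
    fun hf => hf.pos_part.bdd_mul hφ.aestronglyMeasurable (Filter.Eventually.of_forall hM)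
  rw [withDensityᵥ_eq_withDensity_pos_part_sub_withDensity_neg_part hg,
    VectorMeasure.integral_sub_vectorMeasure (hint _) (hint _)]
  have hflip : (ContinuousLinearMap.lsmul ℝ ℝ : ℝ →L[ℝ] ℝ →L[ℝ] ℝ) =
      (ContinuousLinearMap.lsmul ℝ ℝ).flip := by ext; simp
  rw [hflip, VectorMeasure.integral_toSignedMeasure, VectorMeasure.integral_toSignedMeasure]
  have hneg := hden hg.neg
  simp only [Pi.neg_apply] at hneg
  rw [hden hg, hneg, ← integral_sub (hint2 hg) (by simpa using hint2 hg.neg)]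
  congr 1 with x
  rcases le_total (g x) 0 with h | h
  · rw [max_eq_right h, max_eq_left (by linarith)]; ring
  · rw [max_eq_left h, max_eq_right (by linarith)]; ring

namespace Anzellotti

/-! ### Mollification of functions and of measures -/

section Mollify

variable {E : Type*} [NormedAddCommGroup E] [InnerProductSpace ℝ E] [FiniteDimensional ℝ E]
  [MeasurableSpace E] [BorelSpace E]

/-- The convolution of `f` with a smooth bump function of integral one. -/
noncomputable def mollify {F : Type*} [NormedAddCommGroup F] [NormedSpace ℝ F]
    (η : ContDiffBump (0 : E)) (f : E → F) : E → F :=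
  convolution (η.normed volume) f (ContinuousLinearMap.lsmul ℝ ℝ) volume

theorem mollify_apply {F : Type*} [NormedAddCommGroup F] [NormedSpace ℝ F]
    (η : ContDiffBump (0 : E)) (f : E → F) (x : E) :
    mollify η f x = ∫ y, η.normed volume (x - y) • f y :=
  convolution_lsmul_swap

theorem integrable_mollify_integrand {F : Type*} [NormedAddCommGroup F] [NormedSpace ℝ F]
    (η : ContDiffBump (0 : E)) {f : E → F} (hf : LocallyIntegrable f)
    (x : E) : Integrable fun y => η.normed volume (x - y) • f y :=
  (η.hasCompactSupport_normed.convolutionExists_left (ContinuousLinearMap.lsmul ℝ ℝ)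
    η.continuous_normed hf x).integrable_swap

theorem contDiff_mollify (η : ContDiffBump (0 : E)) {f : E → ℝ}
    (hf : LocallyIntegrable f) : ContDiff ℝ (⊤ : ℕ∞) (mollify η f) :=
  η.hasCompactSupport_normed.contDiff_convolution_left _ η.contDiff_normed hf

theorem fderiv_mollify (η : ContDiffBump (0 : E)) {f : E → ℝ}
    (hf : LocallyIntegrable f) (x v : E) :
    fderiv ℝ (mollify η f) x v = ∫ y, fderiv ℝ (η.normed volume) (x - y) v * f y := by
  let L : ℝ →L[ℝ] ℝ →L[ℝ] ℝ := ContinuousLinearMap.lsmul ℝ ℝ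
  have h1 : ContDiff ℝ 1 (η.normed volume) := η.contDiff_normed (n := 1)
  have h2 : HasFDerivAt (mollify η f) (convolution (fderiv ℝ (η.normed volume)) f
      (L.precompL (E)) volume x) x :=
    η.hasCompactSupport_normed.hasFDerivAt_convolution_left L h1 hf x
  have h3 : Integrable fun y => L.precompL (E) (fderiv ℝ (η.normed volume) (x - y)) (f y) :=
    ((η.hasCompactSupport_normed.fderiv ℝ).convolutionExists_left (L.precompL (E))
      (h1.continuous_fderiv one_ne_zero) hf x).integrable_swap
  rw [h2.fderiv, convolution_eq_swap, ContinuousLinearMap.integral_apply h3]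
  rfl

theorem tendsto_setIntegral_inner_mollify {F : Type*} [NormedAddCommGroup F]
    [InnerProductSpace ℝ F] [CompleteSpace F] {p q : ℝ≥0∞} [p.HolderConjugate q]
    {s : Set E} (hm : MeasurableSet s) {w f : E → F} (hw : MemLp w p (volume.restrict s))
    (hf : MemLp f q (volume.restrict s)) {ι : Type*} {l : Filter ι}
    {η : ι → ContDiffBump (0 : E)}
    (hη : Filter.Tendsto (fun k => (η k).rOut) l (nhds 0)) :
    Filter.Tendsto
      (fun k => ∫ x in s, ⟪w x, mollify (η k) (s.indicator f) x⟫) l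
      (nhds (∫ x in s, ⟪w x, f x⟫)) := by
  have hw' : MemLp (s.indicator w) p volume := (memLp_indicator_iff_restrict hm).2 hw
  have hf' : MemLp (s.indicator f) q volume := (memLp_indicator_iff_restrict hm).2 hf
  have h : Filter.Tendsto (fun k => ∫ x, ⟪s.indicator w x, mollify (η k) (s.indicator f) x⟫) l
      (nhds (∫ x, ⟪s.indicator w x, s.indicator f x⟫)) :=
    tendsto_integral_inner_convolution hw' hf' hη
  have h1 : ∀ a b : E → F, (∀ x ∈ s, a x = b x) →
      ∫ x, ⟪s.indicator w x, a x⟫ = ∫ x in s, ⟪w x, b x⟫ := fun a b hab => by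
    rw [← integral_indicator hm]
    congr 1 with x
    by_cases hx : x ∈ s
    · simp only [Set.indicator_of_mem hx, hab x hx]
    · simp [Set.indicator_of_notMem hx]
  rw [h1 _ f fun x hx => Set.indicator_of_mem hx f] at h
  refine h.congr fun k => ?_
  exact h1 (mollify (η k) (s.indicator f))
    (mollify (η k) (s.indicator f)) fun _ _ => rfl

theorem lintegral_enorm_normed_sub (η : ContDiffBump (0 : E)) (y : E) :
    ∫⁻ x, ‖η.normed volume (x - y)‖ₑ = 1 := by
  rw [lintegral_sub_right_eq_self (fun x => ‖η.normed volume x‖ₑ) y]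
  have h := integral_norm_eq_lintegral_enorm (μ := volume) η.integrable_normed.1
  simp_rw [Real.norm_of_nonneg (η.nonneg_normed _)] at h
  rw [η.integral_normed] at h
  rw [← ENNReal.toReal_eq_one_iff, h]

/-- Where `ρ (x - y)` does not vanish, `φ x` may be replaced by `φ y + δ`; after Tonelli the
integral of `ρ` in `x` is one. This removes the mollifier from a measure at the cost of the
oscillation of `φ`. -/
theorem lintegral_mul_lintegral_sub_le {ρ φ : E → ℝ≥0∞} (hρ : Measurable ρ)
    (hρ1 : ∀ y, ∫⁻ x, ρ (x - y) = 1) (μ : Measure E) [SFinite μ] (hφ : Measurable φ) {δ : ℝ≥0∞}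
    (hδ : ∀ x y, ρ (x - y) ≠ 0 → φ x ≤ φ y + δ) :
    ∫⁻ x, φ x * ∫⁻ y, ρ (x - y) ∂μ ≤ (∫⁻ y, φ y ∂μ) + δ * μ Set.univ := by
  have hm : Measurable (fun w : E × E => (φ w.2 + δ) * ρ (w.1 - w.2)) :=
    ((hφ.comp measurable_snd).add_const δ).mul (hρ.comp (measurable_fst.sub measurable_snd))
  have hpt : ∀ x y, φ x * ρ (x - y) ≤ (φ y + δ) * ρ (x - y) := fun x y => by
    by_cases h : ρ (x - y) = 0
    · simp [h]
    · have h1 := hδ x y h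
      gcongr
  calc _ ≤ ∫⁻ x, ∫⁻ y, (φ y + δ) * ρ (x - y) ∂μ := by
        refine lintegral_mono fun x => ?_
        rw [← lintegral_const_mul _ (by fun_prop : Measurable fun y => ρ (x - y))]
        exact lintegral_mono fun y => hpt x y
    _ = ∫⁻ y, ∫⁻ x, (φ y + δ) * ρ (x - y) ∂volume ∂μ :=
        lintegral_lintegral_swap hm.aemeasurable
    _ = ∫⁻ y, (φ y + δ) ∂μ := by
        refine lintegral_congr fun y => ?_
        rw [lintegral_const_mul _ (by fun_prop : Measurable fun x => ρ (x - y)), hρ1, mul_one]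
    _ = _ := by
        rw [lintegral_add_right _ measurable_const, lintegral_const]

theorem lintegral_enorm_mul_lintegral_normed_le (η : ContDiffBump (0 : E))
    (μ : Measure E) [IsFiniteMeasure μ] {φ : E → ℝ} (hφ : Measurable φ) {δ : ℝ≥0∞}
    (hδ : ∀ x y, dist x y ≤ η.rOut → ‖φ x‖ₑ ≤ ‖φ y‖ₑ + δ) :
    ∫⁻ x, ‖φ x‖ₑ * ∫⁻ y, ‖η.normed volume (x - y)‖ₑ ∂μ ≤
      (∫⁻ y, ‖φ y‖ₑ ∂μ) + δ * μ Set.univ := by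
  refine lintegral_mul_lintegral_sub_le (ρ := fun t => ‖η.normed volume t‖ₑ)
    η.continuous_normed.measurable.enorm (lintegral_enorm_normed_sub η) μ hφ.enorm
    fun x y h => hδ x y ?_
  have h1 : x - y ∈ Function.support (η.normed volume) := enorm_ne_zero.1 h
  rw [η.support_normed_eq, mem_ball_zero_iff, ← dist_eq_norm] at h1
  exact h1.le

end Mollify

variable {m : ℕ} {n : Fin (m + 1) → ℕ} {Ω : Opens (Space n)}

/-! ### Partial gradients and test functions -/

/-- The embedding of `ℝ^{n_i}` into `ℝ^N`. -/
noncomputable def blockVec (i : Fin (m + 1)) (a : Block n i) : Space n := ∑ j, a j • basisVec i j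

theorem inner_gradBlock (i : Fin (m + 1)) (a : Block n i) (φ : Space n → ℝ) (x : Space n) :
    ⟪a, gradBlock i φ x⟫ = fderiv ℝ φ x (blockVec i a) := by
  simp [blockVec, gradBlock, PiLp.inner_apply, map_sum, mul_comm]

theorem gradBlock_add {i : Fin (m + 1)} {f g : Space n → ℝ} {x : Space n}
    (hf : DifferentiableAt ℝ f x) (hg : DifferentiableAt ℝ g x) :
    gradBlock i (f + g) x = gradBlock i f x + gradBlock i g x := by
  refine ext_inner_left ℝ fun a => ?_
  simp only [inner_add_right, inner_gradBlock]
  rw [fderiv_add hf hg]; rfl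

theorem gradBlock_smul {i : Fin (m + 1)} {f : Space n → ℝ} {x : Space n} (c : ℝ)
    (hf : DifferentiableAt ℝ f x) : gradBlock i (c • f) x = c • gradBlock i f x := by
  refine ext_inner_left ℝ fun a => ?_
  simp only [inner_smul_right, inner_gradBlock]
  rw [fderiv_const_smul hf]; rfl

theorem gradBlock_mul {i : Fin (m + 1)} {f g : Space n → ℝ} {x : Space n}
    (hf : DifferentiableAt ℝ f x) (hg : DifferentiableAt ℝ g x) :
    gradBlock i (fun y => f y * g y) x = f x • gradBlock i g x + g x • gradBlock i f x := by
  refine ext_inner_left ℝ fun a => ?_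
  simp only [inner_add_right, inner_smul_right, inner_gradBlock]
  rw [fderiv_fun_mul hf hg]; rfl

theorem continuous_gradBlock (i : Fin (m + 1)) {φ : Space n → ℝ} (hφ : ContDiff ℝ 1 φ) :
    Continuous (gradBlock i φ) := by
  unfold gradBlock
  have := hφ.continuous_fderiv one_ne_zero
  fun_prop

theorem exists_norm_le (φ : 𝓓(Ω, ℝ)) : ∃ M, ∀ x, ‖φ x‖ ≤ M :=
  φ.continuous.bounded_above_of_compact_support φ.hasCompactSupport

theorem divBlock_smul_const {i : Fin (m + 1)} {f : Space n → ℝ} {y : Space n}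
    (hf : DifferentiableAt ℝ f y) (a : Block n i) :
    divBlock i (fun y => f y • a) y = fderiv ℝ f y (blockVec i a) := by
  simp [divBlock, blockVec, fderiv_smul_const hf, map_sum, mul_comm]

/-- The test function `φ • a`. -/
noncomputable def smulConst {i : Fin (m + 1)} (φ : 𝓓(Ω, ℝ)) (a : Block n i) : 𝓓(Ω, Block n i) where
  toFun x := φ x • a
  contDiff' := φ.contDiff.smul contDiff_const
  hasCompactSupport' := φ.hasCompactSupport.smul_right
  tsupport_subset' := (closure_mono (Function.support_smul_subset_left _ _)).trans
    φ.tsupport_subset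

/-- The test function `y ↦ η (x - y)`. -/
noncomputable def bumpTest (η : ContDiffBump (0 : Space n)) {x : Space n}
    (hx : Metric.closedBall x η.rOut ⊆ Ω) : 𝓓(Ω, ℝ) :=
  have hs : Function.support (fun y => η.normed volume (x - y)) ⊆ Metric.closedBall x η.rOut := by
    intro y hy
    have : x - y ∈ Function.support (η.normed volume) := hy
    rw [η.support_normed_eq, mem_ball_zero_iff] at this
    rw [Metric.mem_closedBall, dist_comm, dist_eq_norm]
    exact this.le
  { toFun := fun y => η.normed volume (x - y)
    contDiff' := η.contDiff_normed.comp (contDiff_const.sub contDiff_id)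
    hasCompactSupport' :=
      HasCompactSupport.of_support_subset_isCompact (isCompact_closedBall _ _) hs
    tsupport_subset' := (closure_minimal hs Metric.isClosed_closedBall).trans hx }

/-! ### Partial gradients of the mollified function inside `Ω` -/

/-- The derivative falls on the kernel, and differentiating `η (x - y)` in `y` changes the sign. The
kernel is a test function on `Ω` because its ball lies in `Ω`, so the jump of the zero extension is
not seen. -/
theorem inner_gradBlock_mollify (η : ContDiffBump (0 : Space n)) {u : Space n → ℝ}
    (hu : IntegrableOn u Ω) {x : Space n} (hx : Metric.closedBall x η.rOut ⊆ Ω)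
    {i : Fin (m + 1)} (a : Block n i) :
    ⟪a, gradBlock i (mollify η ((Ω : Set (Space n)).indicator u)) x⟫ =
      - ∫ y in Ω, u y * divBlock i (smulConst (bumpTest η hx) a) y := by
  have hui : Integrable ((Ω : Set (Space n)).indicator u) :=
    hu.integrable_indicator Ω.isOpen.measurableSet
  rw [inner_gradBlock, fderiv_mollify η hui.locallyIntegrable, ← integral_neg,
    ← integral_indicator Ω.isOpen.measurableSet]
  congr 1 with y
  have hd : DifferentiableAt ℝ (η.normed volume) (x - y) :=
    (η.contDiff_normed (n := 1)).differentiable one_ne_zero _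
  have h1 : HasFDerivAt (bumpTest η hx) (-fderiv ℝ (η.normed volume) (x - y)) y := by
    have := hd.hasFDerivAt.comp y ((hasFDerivAt_id y).const_sub x)
    simpa using! this
  have h2 : divBlock i (smulConst (bumpTest η hx) a) y =
      -fderiv ℝ (η.normed volume) (x - y) (blockVec i a) := by
    refine (divBlock_smul_const h1.differentiableAt a).trans ?_
    rw [h1.fderiv]; rfl
  by_cases hy : y ∈ (Ω : Set (Space n))
  · simp only [Set.indicator_of_mem hy, h2]; ring
  · simp [Set.indicator_of_notMem hy]

theorem IsWeakGradBlock.gradBlock_mollify {i : Fin (m + 1)} {u : Space n → ℝ}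
    {G : Space n → Block n i} (hG : IsWeakGradBlock Ω i u G) (hGi : IntegrableOn G Ω)
    (hu : IntegrableOn u Ω) {η : ContDiffBump (0 : Space n)} {x : Space n}
    (hx : Metric.closedBall x η.rOut ⊆ Ω) :
    gradBlock i (mollify η ((Ω : Set (Space n)).indicator u)) x =
      mollify η ((Ω : Set (Space n)).indicator G) x := by
  refine ext_inner_left ℝ fun a => ?_
  have hl := (hGi.integrable_indicator Ω.isOpen.measurableSet).locallyIntegrable
  rw [inner_gradBlock_mollify η hu hx, hG.eq, neg_neg, mollify_apply,
    ← integral_inner (integrable_mollify_integrand η hl x),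
    ← integral_indicator Ω.isOpen.measurableSet]
  congr 1 with y
  by_cases hy : y ∈ (Ω : Set (Space n))
  · simp only [Set.indicator_of_mem hy, inner_smul_right]
    exact real_inner_smul_left _ _ _
  · simp [Set.indicator_of_notMem hy]

/-- The derivative at `x` is the integral of the kernel times `a` against the measure `D_{x_i}u`,
hence at most `‖a‖ₑ` times the mollified total variation. -/
theorem IsDistribGradBlock.enorm_inner_gradBlock_mollify_le {i : Fin (m + 1)} {u : Space n → ℝ}
    {μ : VectorMeasure (Space n) (Block n i)} (hμ : IsDistribGradBlock Ω i u μ)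
    (hu : IntegrableOn u Ω) {η : ContDiffBump (0 : Space n)} {x : Space n}
    (hx : Metric.closedBall x η.rOut ⊆ Ω) (a : Block n i) :
    ‖⟪a, gradBlock i (mollify η ((Ω : Set (Space n)).indicator u)) x⟫‖ₑ ≤
      ‖a‖ₑ * ∫⁻ y, ‖η.normed volume (x - y)‖ₑ ∂μ.variation := by
  rw [inner_gradBlock_mollify η hu hx, hμ.eq, neg_neg]
  refine VectorMeasure.enorm_integral_le_lintegral_enorm.trans ?_
  have h1 : ‖(innerSL ℝ : Block n i →L[ℝ] Block n i →L[ℝ] ℝ)‖ₑ ≤ 1 := by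
    rw [← ofReal_norm]
    exact ENNReal.ofReal_le_one.2 (norm_innerSL_le ℝ)
  refine (mul_le_of_le_one_left zero_le h1).trans_eq ?_
  rw [← lintegral_const_mul]
  · refine lintegral_congr fun y => ?_
    change ‖η.normed volume (x - y) • a‖ₑ = _
    rw [enorm_smul, mul_comm]
  · exact (η.continuous_normed.comp (continuous_const.sub continuous_id)).measurable.enorm

/-! ### Uniqueness of weak gradients and divergences -/

/-- This carries integrability from a given weak gradient to the one chosen in `weakGradBlock`; the
same is done for `weakDiv` below. -/
theorem IsWeakGradBlock.ae_eq {i : Fin (m + 1)} {u : Space n → ℝ} {G G' : Space n → Block n i}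
    (hG : IsWeakGradBlock Ω i u G) (hG' : IsWeakGradBlock Ω i u G') :
    G =ᵐ[volume.restrict (Ω : Set (Space n))] G' := by
  rw [Filter.EventuallyEq, ae_restrict_iff' Ω.isOpen.measurableSet]
  have h := Ω.isOpen.ae_eq_zero_of_integral_contDiff_smul_eq_zero (μ := volume)
    (hG.locallyIntegrable.sub hG'.locallyIntegrable) fun g hg hgc hgs => ?_
  · filter_upwards [h] with x hx hxΩ
    exact sub_eq_zero.1 (hx hxΩ)
  · let φ : 𝓓(Ω, ℝ) := ⟨g, hg, hgc, hgs⟩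
    have hint : ∀ {H : Space n → Block n i}, LocallyIntegrableOn H Ω →
        IntegrableOn (fun x => g x • H x) Ω := fun hH =>
      (φ.integrable_bilin (ContinuousLinearMap.lsmul ℝ ℝ) hH).integrableOn
    have h0 : ∫ x, g x • (G - G') x = ∫ x in Ω, g x • (G - G') x := by
      refine (setIntegral_eq_integral_of_forall_compl_eq_zero fun x hx => ?_).symm
      rw [image_eq_zero_of_notMem_tsupport (fun h => hx (hgs h)), zero_smul]
    rw [h0]
    simp only [Pi.sub_apply, smul_sub]
    rw [integral_sub (hint hG.locallyIntegrable) (hint hG'.locallyIntegrable), sub_eq_zero]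
    refine ext_inner_left ℝ fun a => ?_
    rw [← integral_inner (hint hG.locallyIntegrable), ← integral_inner (hint hG'.locallyIntegrable)]
    have := (hG.eq (smulConst φ a)).symm.trans (hG'.eq (smulConst φ a))
    rw [neg_inj] at this
    have hc : ∀ (H : Space n → Block n i) x, ⟪smulConst φ a x, H x⟫ = ⟪a, g x • H x⟫ :=
      fun H x => by
        rw [inner_smul_right]; exact real_inner_smul_left _ _ _
    simpa only [hc] using this

theorem IsWeakDiv.ae_eq {z : ∀ i, Space n → Block n i} {g g' : Space n → ℝ}
    (hg : IsWeakDiv Ω z g) (hg' : IsWeakDiv Ω z g') :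
    g =ᵐ[volume.restrict (Ω : Set (Space n))] g' := by
  rw [Filter.EventuallyEq, ae_restrict_iff' Ω.isOpen.measurableSet]
  have h := Ω.isOpen.ae_eq_zero_of_integral_contDiff_smul_eq_zero (μ := volume)
    (hg.locallyIntegrable.sub hg'.locallyIntegrable) fun f hf hfc hfs => ?_
  · filter_upwards [h] with x hx hxΩ
    exact sub_eq_zero.1 (hx hxΩ)
  · let φ : 𝓓(Ω, ℝ) := ⟨f, hf, hfc, hfs⟩
    have hint : ∀ {h : Space n → ℝ}, LocallyIntegrableOn h Ω →
        IntegrableOn (fun x => h x * f x) Ω := fun hh =>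
      (φ.integrable_bilin (ContinuousLinearMap.mul ℝ ℝ).flip hh).integrableOn
    have h0 : ∫ x, f x • (g - g') x = ∫ x in Ω, f x • (g - g') x := by
      refine (setIntegral_eq_integral_of_forall_compl_eq_zero fun x hx => ?_).symm
      rw [image_eq_zero_of_notMem_tsupport (fun h => hx (hfs h)), zero_smul]
    rw [h0]
    simp only [Pi.sub_apply, smul_eq_mul, mul_comm (f _), sub_mul]
    rw [integral_sub (hint hg.locallyIntegrable) (hint hg'.locallyIntegrable), sub_eq_zero]
    exact (hg.eq φ).trans (hg'.eq φ).symm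

/-! ### The product rule for smooth functions and its limit -/

theorem hasCompactSupport_gradBlock (i : Fin (m + 1)) (φ : 𝓓(Ω, ℝ)) :
    HasCompactSupport (gradBlock i φ) := by
  refine (φ.hasCompactSupport.fderiv ℝ).mono fun x hx => ?_
  contrapose! hx
  simp only [Function.mem_support, not_not] at hx ⊢
  ext j
  simp [gradBlock, hx]

theorem continuous_gradBlock_testFunction (i : Fin (m + 1)) (φ : 𝓓(Ω, ℝ)) :
    Continuous (gradBlock i φ) :=
  continuous_gradBlock i (φ.contDiff.of_le (by norm_cast))

theorem memLp_top_gradBlock (i : Fin (m + 1)) (φ : 𝓓(Ω, ℝ)) {μ : Measure (Space n)} :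
    MemLp (gradBlock i φ) ∞ μ :=
  (continuous_gradBlock_testFunction i φ).memLp_top_of_hasCompactSupport
    (hasCompactSupport_gradBlock i φ) μ

theorem integrableOn_inner_of_hasCompactSupport {F : Type*} [NormedAddCommGroup F]
    [InnerProductSpace ℝ F] {z c : Space n → F} (hz : IntegrableOn z Ω) (hc : Continuous c)
    (hcs : HasCompactSupport c) : IntegrableOn (fun x => ⟪z x, c x⟫) Ω :=
  memLp_one_iff_integrable.1 ((innerSL ℝ).memLp_of_bilin 1 (memLp_one_iff_integrable.2 hz)
    (hc.memLp_top_of_hasCompactSupport hcs _))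

/-- The product of a smooth function and a test function. -/
noncomputable def mulTest {v : Space n → ℝ} (hv : ContDiff ℝ (⊤ : ℕ∞) v) (φ : 𝓓(Ω, ℝ)) : 𝓓(Ω, ℝ) where
  toFun x := v x * φ x
  contDiff' := hv.mul φ.contDiff
  hasCompactSupport' := φ.hasCompactSupport.mul_left
  tsupport_subset' := (closure_mono (Function.support_mul_subset_right _ _)).trans
    φ.tsupport_subset

/-- Test the divergence with `v φ` and expand the gradient by the product rule. -/
theorem IsWeakDiv.pairing_contDiff {z : ∀ i, Space n → Block n i} {g : Space n → ℝ}
    (hg : IsWeakDiv Ω z g) (hz : ∀ i, IntegrableOn (z i) Ω) {v : Space n → ℝ}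
    (hv : ContDiff ℝ (⊤ : ℕ∞) v) (φ : 𝓓(Ω, ℝ)) :
    ∑ i, ∫ x in Ω, φ x * ⟪z i x, gradBlock i v x⟫ =
      -(∫ x in Ω, v x * φ x * g x) - ∑ i, ∫ x in Ω, v x * ⟪z i x, gradBlock i φ x⟫ := by
  have h := hg.eq (mulTest hv φ)
  have hv1 : ContDiff ℝ 1 v := hv.of_le (by norm_cast)
  have h1 : ∀ i x, ⟪z i x, gradBlock i (mulTest hv φ) x⟫ =
      v x * ⟪z i x, gradBlock i φ x⟫ + φ x * ⟪z i x, gradBlock i v x⟫ := fun i x => by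
    have := gradBlock_mul (i := i) (hv1.differentiable one_ne_zero x)
      (φ.contDiff.differentiable (by simp) x)
    rw [← real_inner_smul_right, ← real_inner_smul_right, ← inner_add_right, ← this]
    rfl
  have h2 : ∀ i, ∫ x in Ω, ⟪z i x, gradBlock i (mulTest hv φ) x⟫ =
      (∫ x in Ω, v x * ⟪z i x, gradBlock i φ x⟫) + ∫ x in Ω, φ x * ⟪z i x, gradBlock i v x⟫ :=
    fun i => by
      simp_rw [h1]
      refine integral_add ?_ ?_
      · have := integrableOn_inner_of_hasCompactSupport (hz i)
          (hv.continuous.smul (continuous_gradBlock_testFunction i φ))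
          (hasCompactSupport_gradBlock i φ).smul_left
        simpa only [IntegrableOn, Pi.smul_apply', inner_smul_right] using this
      · have := integrableOn_inner_of_hasCompactSupport (hz i)
          (φ.continuous.smul (continuous_gradBlock i hv1)) φ.hasCompactSupport.smul_right
        simpa only [IntegrableOn, Pi.smul_apply', inner_smul_right] using this
  have h3 : ∫ x in Ω, g x * mulTest hv φ x = ∫ x in Ω, v x * φ x * g x := by
    congr 1 with x
    exact mul_comm _ _
  simp_rw [h2, Finset.sum_add_distrib] at h
  rw [h3] at h
  linarith

theorem eventually_closedBall_subset (φ : 𝓓(Ω, ℝ)) {ι : Type*} {l : Filter ι}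
    {η : ι → ContDiffBump (0 : Space n)}
    (hη : Filter.Tendsto (fun k => (η k).rOut) l (nhds 0)) :
    ∀ᶠ k in l, ∀ x ∈ tsupport φ, Metric.closedBall x (η k).rOut ⊆ Ω := by
  obtain ⟨δ, hδ, hsub⟩ := φ.hasCompactSupport.isCompact.exists_cthickening_subset_open Ω.isOpen
    φ.tsupport_subset
  filter_upwards [hη.eventually_lt_const hδ] with k hk x hx
  exact (Metric.closedBall_subset_closedBall hk.le).trans
    ((Metric.closedBall_subset_cthickening hx δ).trans hsub)

/-- The first block is not treated directly, since there the gradient of `u` is only a measure: it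
is what the product rule leaves after subtracting the other blocks, all of whose limits are known.
-/
theorem tendsto_integral_inner_gradBlock_mollify
    [IsFiniteMeasure (volume.restrict (Ω : Set (Space n)))]
    {s p : Fin (m + 1) → ℝ≥0∞} [hsp : ∀ i, (s i).HolderConjugate (p i)]
    {r q : ℝ≥0∞} [r.HolderConjugate q] {u g : Space n → ℝ} {z : ∀ i, Space n → Block n i}
    {G : ∀ i : Fin m, Space n → Block n i.succ}
    (hup : ∀ i, MemLp u (p i) (volume.restrict (Ω : Set (Space n))))
    (huq : MemLp u q (volume.restrict (Ω : Set (Space n))))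
    (hz : ∀ i, MemLp (z i) (s i) (volume.restrict (Ω : Set (Space n))))
    (hg : IsWeakDiv Ω z g) (hgr : MemLp g r (volume.restrict (Ω : Set (Space n))))
    (hG : ∀ i, IsWeakGradBlock Ω i.succ u (G i))
    (hGp : ∀ i, MemLp (G i) (p i.succ) (volume.restrict (Ω : Set (Space n))))
    (φ : 𝓓(Ω, ℝ)) {ι : Type*} {l : Filter ι} {η : ι → ContDiffBump (0 : Space n)}
    (hη : Filter.Tendsto (fun k => (η k).rOut) l (nhds 0)) :
    Filter.Tendsto (fun k => ∫ x in Ω, φ x *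
        ⟪z 0 x, gradBlock 0 (mollify (η k) ((Ω : Set (Space n)).indicator u)) x⟫) l
      (nhds (-(∫ x in Ω, u x * φ x * g x) - (∑ i, ∫ x in Ω, u x * ⟪z i x, gradBlock i φ x⟫)
        - ∑ i : Fin m, ∫ x in Ω, φ x * ⟪z i.succ x, G i x⟫)) := by
  have hp1 : ∀ i, 1 ≤ p i := fun i => ENNReal.HolderConjugate.one_le (p i) (s i)
  have hs1 : ∀ i, 1 ≤ s i := fun i => ENNReal.HolderConjugate.one_le (s i) (p i)
  have hui : IntegrableOn u Ω := (hup 0).integrable (hp1 0)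
  have hul : LocallyIntegrable ((Ω : Set (Space n)).indicator u) :=
    (hui.integrable_indicator Ω.isOpen.measurableSet).locallyIntegrable
  have h1 : Filter.Tendsto (fun k => ∫ x in Ω,
      mollify (η k) ((Ω : Set (Space n)).indicator u) x * φ x * g x) l
      (nhds (∫ x in Ω, u x * φ x * g x)) := by
    have hw : MemLp (fun x => φ x * g x) r (volume.restrict (Ω : Set (Space n))) :=
      hgr.mul φ.memLp_top
    have := tendsto_setIntegral_inner_mollify Ω.isOpen.measurableSet hw huq hη
    simpa only [RCLike.inner_apply, conj_trivial, mul_assoc] using this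
  have h2 : ∀ i, Filter.Tendsto (fun k => ∫ x in Ω,
      mollify (η k) ((Ω : Set (Space n)).indicator u) x * ⟪z i x, gradBlock i φ x⟫) l
      (nhds (∫ x in Ω, u x * ⟪z i x, gradBlock i φ x⟫)) := fun i => by
    have hw : MemLp (fun x => ⟪z i x, gradBlock i φ x⟫) (s i)
        (volume.restrict (Ω : Set (Space n))) :=
      (innerSL ℝ).memLp_of_bilin (s i) (hz i) (memLp_top_gradBlock i φ)
    have := tendsto_setIntegral_inner_mollify Ω.isOpen.measurableSet hw (hup i) hη
    simpa only [RCLike.inner_apply, conj_trivial] using this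
  have h3 : ∀ i : Fin m, Filter.Tendsto (fun k => ∫ x in Ω, φ x *
      ⟪z i.succ x, gradBlock i.succ (mollify (η k) ((Ω : Set (Space n)).indicator u)) x⟫) l
      (nhds (∫ x in Ω, φ x * ⟪z i.succ x, G i x⟫)) := fun i => by
    have hw : MemLp (fun x => φ x • z i.succ x) (s i.succ)
        (volume.restrict (Ω : Set (Space n))) := (hz i.succ).smul φ.memLp_top
    have := tendsto_setIntegral_inner_mollify Ω.isOpen.measurableSet hw (hGp i) hη
    simp only [real_inner_smul_left] at this
    -- Only for small radii does mollification commute with the weak gradient on the whole support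
    -- of `φ`.
    refine this.congr' ?_
    filter_upwards [eventually_closedBall_subset φ hη] with k hk
    congr 1 with x
    by_cases hx : x ∈ tsupport φ
    · rw [(hG i).gradBlock_mollify ((hGp i).integrable (hp1 _)) hui (hk x hx)]
    · simp [image_eq_zero_of_notMem_tsupport hx]
  refine ((h1.neg.sub (tendsto_finsetSum _ fun i _ => h2 i)).sub
    (tendsto_finsetSum _ fun i _ => h3 i)).congr fun k => ?_
  rw [← hg.pairing_contDiff (fun i => (hz i).integrable (hs1 i)) (contDiff_mollify (η k) hul) φ,
    Fin.sum_univ_succ, add_sub_cancel_right]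

/-! ### Bounds by the total variation -/

/-- Bound `z` by its essential supremum and the gradient by the mollified variation, then move the
mollifier off the measure; `δ` is the oscillation of `φ` at the scale of the mollifier. -/
theorem IsDistribGradBlock.enorm_integral_mollify_le {u : Space n → ℝ} {i : Fin (m + 1)}
    {μ : VectorMeasure (Space n) (Block n i)} (hμ : IsDistribGradBlock Ω i u μ)
    (hu : IntegrableOn u Ω) (z : Space n → Block n i) (φ : 𝓓(Ω, ℝ))
    {η : ContDiffBump (0 : Space n)} (hη : ∀ x ∈ tsupport φ, Metric.closedBall x η.rOut ⊆ Ω)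
    {δ : ℝ≥0∞} (hδ : ∀ x y, dist x y ≤ η.rOut → ‖φ x‖ₑ ≤ ‖φ y‖ₑ + δ) :
    ‖∫ x in Ω, φ x * ⟪z x, gradBlock i (mollify η ((Ω : Set (Space n)).indicator u)) x⟫‖ₑ ≤
      eLpNorm z ∞ (volume.restrict (Ω : Set (Space n))) *
        ((∫⁻ y, ‖φ y‖ₑ ∂μ.variation) + δ * μ.variation Set.univ) := by
  have : IsFiniteMeasure μ.variation := ⟨hμ.radon.finite_variation⟩
  have hb : ∀ x ∈ tsupport φ, ∀ a : Block n i,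
      ‖⟪a, gradBlock i (mollify η ((Ω : Set (Space n)).indicator u)) x⟫‖ₑ ≤
      ‖a‖ₑ * ∫⁻ y, ‖η.normed volume (x - y)‖ₑ ∂μ.variation := fun x hx a =>
    hμ.enorm_inner_gradBlock_mollify_le hu (hη x hx) a
  generalize gradBlock i (mollify η ((Ω : Set (Space n)).indicator u)) = D at hb ⊢
  have hzC : ∀ᵐ x ∂(volume.restrict (Ω : Set (Space n))),
      ‖z x‖ₑ ≤ eLpNorm z ∞ (volume.restrict (Ω : Set (Space n))) := by
    rw [eLpNorm_exponent_top]; exact ae_le_eLpNormEssSup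
  generalize eLpNorm z ∞ (volume.restrict (Ω : Set (Space n))) = C at hzC ⊢
  have hm : Measurable (fun x => ‖φ x‖ₑ * ∫⁻ y, ‖η.normed volume (x - y)‖ₑ ∂μ.variation) :=
    φ.continuous.measurable.enorm.mul (Measurable.lintegral_prod_right
      (η.continuous_normed.comp (continuous_fst.sub continuous_snd)).measurable.enorm)
  refine (enorm_integral_le_lintegral_enorm _).trans ?_
  refine le_trans ?_ (mul_le_mul_right
    (lintegral_enorm_mul_lintegral_normed_le η μ.variation φ.continuous.measurable hδ) C)
  rw [← lintegral_const_mul _ hm]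
  refine le_trans (lintegral_mono_ae ?_) (setLIntegral_le_lintegral (Ω : Set (Space n)) _)
  filter_upwards [hzC] with x hx
  by_cases hxφ : x ∈ tsupport φ
  · rw [enorm_mul, mul_left_comm]
    exact mul_le_mul_right ((hb x hxφ (z x)).trans (mul_le_mul_left hx _)) _
  · simp [image_eq_zero_of_notMem_tsupport hxφ]

theorem isBounded_prodDomain {Ω₁ : Opens (Block n 0)} {Ω₂ : Opens (Rest n)}
    (h₁ : Bornology.IsBounded (Ω₁ : Set (Block n 0)))
    (h₂ : Bornology.IsBounded (Ω₂ : Set (Rest n))) :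
    Bornology.IsBounded (prodDomain Ω₁ Ω₂ : Set (Space n)) := by
  obtain ⟨R₁, hR₁⟩ := h₁.exists_norm_le
  obtain ⟨R₂, hR₂⟩ := h₂.exists_norm_le
  refine isBounded_iff_forall_norm_le.2 ⟨√(R₁ ^ 2 + R₂ ^ 2), fun x hx => Real.le_sqrt_of_sq_le ?_⟩
  have hsq : ‖x‖ ^ 2 = ‖firstBlock x‖ ^ 2 + ‖restBlocks x‖ ^ 2 := by
    simp [EuclideanSpace.norm_sq_eq, firstBlock, restBlocks, Fintype.sum_sigma, Fin.sum_univ_succ]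
  rw [hsq]
  have h1 := hR₁ _ hx.1
  have h2 := hR₂ _ hx.2
  gcongr

theorem isDistribGradBlock_distribGradBlock {i : Fin (m + 1)} {u : Space n → ℝ}
    (h : ∃ μ, IsDistribGradBlock Ω i u μ) : IsDistribGradBlock Ω i u (distribGradBlock Ω i u) :=
  Classical.epsilon_spec h

theorem IsWeakGradBlock.weakGradBlock {i : Fin (m + 1)} {u : Space n → ℝ}
    {G : Space n → Block n i} (h : IsWeakGradBlock Ω i u G) :
    IsWeakGradBlock Ω i u (weakGradBlock Ω i u) :=
  Classical.epsilon_spec ⟨G, h⟩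

theorem IsWeakDiv.weakDiv {z : ∀ i, Space n → Block n i} {g : Space n → ℝ}
    (h : IsWeakDiv Ω z g) : IsWeakDiv Ω z (weakDiv Ω z) :=
  Classical.epsilon_spec ⟨g, h⟩

/-- Integration of test functions against an integrable density. -/
noncomputable def integralMul {h : Space n → ℝ} (hh : IntegrableOn h Ω) : 𝓓(Ω, ℝ) →ₗ[ℝ] ℝ where
  toFun φ := ∫ x in Ω, φ x * h x
  map_add' φ ψ := by
    have hi : ∀ φ : 𝓓(Ω, ℝ), IntegrableOn (fun x => φ x * h x) Ω := fun φ =>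
      (φ.integrable_bilin (ContinuousLinearMap.mul ℝ ℝ) hh.locallyIntegrableOn).integrableOn
    rw [← integral_add (hi φ) (hi ψ)]
    simp [add_mul]
  map_smul' c φ := by
    simp [mul_assoc, integral_const_mul]

/-- Integration of the partial gradient of test functions against an integrable vector field. -/
noncomputable def integralInnerGradBlock {i : Fin (m + 1)} {w : Space n → Block n i} (hw : IntegrableOn w Ω) :
    𝓓(Ω, ℝ) →ₗ[ℝ] ℝ where
  toFun φ := ∫ x in Ω, ⟪w x, gradBlock i φ x⟫
  map_add' φ ψ := by
    have hi : ∀ φ : 𝓓(Ω, ℝ), IntegrableOn (fun x => ⟪w x, gradBlock i φ x⟫) Ω := fun φ =>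
      integrableOn_inner_of_hasCompactSupport hw (continuous_gradBlock_testFunction i φ)
        (hasCompactSupport_gradBlock i φ)
    rw [← integral_add (hi φ) (hi ψ)]
    congr 1 with x
    rw [← inner_add_right, ← gradBlock_add (φ.contDiff.differentiable (by simp) x)
      (ψ.contDiff.differentiable (by simp) x)]
    rfl
  map_smul' c φ := by
    rw [smul_eq_mul, RingHom.id_apply, ← integral_const_mul]
    congr 1 with x
    rw [← real_inner_smul_right, ← gradBlock_smul c (φ.contDiff.differentiable (by simp) x)]
    rfl

/-- Integrability of the three kinds of products makes the pairing additive in `φ`, as the extension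
to `L¹` requires. -/
theorem exists_linearMap_eq_firstPairing {z : ∀ i, Space n → Block n i} {u : Space n → ℝ}
    (h₁ : IntegrableOn (fun x => u x * weakDiv Ω z x) Ω)
    (h₂ : ∀ i, IntegrableOn (fun x => u x • z i x) Ω)
    (h₃ : ∀ i : Fin m, IntegrableOn (fun x => ⟪z i.succ x, weakGradBlock Ω i.succ u x⟫) Ω) :
    ∃ T : 𝓓(Ω, ℝ) →ₗ[ℝ] ℝ, ∀ φ, T φ = firstPairing Ω z u φ := by
  refine ⟨-integralMul h₁ - (∑ i, integralInnerGradBlock (h₂ i)) - ∑ i, integralMul (h₃ i),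
    fun φ => ?_⟩
  simp only [LinearMap.sub_apply, LinearMap.neg_apply, LinearMap.sum_apply, integralMul,
    integralInnerGradBlock, LinearMap.coe_mk, AddHom.coe_mk, firstPairing, pairing,
    real_inner_smul_left]
  congr 3
  congr 1
  congr 1 with x
  ring

theorem uniform_enorm_le_add (φ : 𝓓(Ω, ℝ)) {δ : ℝ} (hδ : 0 < δ) :
    ∃ ε > 0, ∀ x y, dist x y < ε → ‖φ x‖ₑ ≤ ‖φ y‖ₑ + ENNReal.ofReal δ := by
  have huc := φ.hasCompactSupport.uniformContinuous_of_continuous φ.continuous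
  obtain ⟨ε, hε, h⟩ := Metric.uniformContinuous_iff.1 huc δ hδ
  refine ⟨ε, hε, fun x y hxy => ?_⟩
  have h1 := h hxy
  rw [dist_eq_norm] at h1
  calc ‖φ x‖ₑ = ‖φ y + (φ x - φ y)‖ₑ := by rw [add_sub_cancel]
    _ ≤ ‖φ y‖ₑ + ‖φ x - φ y‖ₑ := enorm_add_le _ _
    _ ≤ _ := by
      gcongr
      rw [← ofReal_norm]
      exact ENNReal.ofReal_le_ofReal h1.le

theorem exists_contDiffBump_seq (E : Type*) [NormedAddCommGroup E] [InnerProductSpace ℝ E] :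
    ∃ η : ℕ → ContDiffBump (0 : E), Filter.Tendsto (fun k => (η k).rOut) Filter.atTop (nhds 0) :=
  ⟨fun k => ⟨1 / ((k : ℝ) + 1) / 2, 1 / ((k : ℝ) + 1), by positivity,
    half_lt_self (by positivity)⟩, tendsto_one_div_add_atTop_nhds_zero_nat⟩

/-- For fixed `δ` the mollification radius tends to zero, by which the bound passes to the limit;
then `δ → 0`, where finiteness of the total variation removes the error term. -/
theorem abs_firstPairing_le [IsFiniteMeasure (volume.restrict (Ω : Set (Space n)))]
    {s p : Fin (m + 1) → ℝ≥0∞} [hsp : ∀ i, (s i).HolderConjugate (p i)]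
    {r q : ℝ≥0∞} [r.HolderConjugate q] {u : Space n → ℝ} {z : ∀ i, Space n → Block n i}
    (hup : ∀ i, MemLp u (p i) (volume.restrict (Ω : Set (Space n))))
    (huq : MemLp u q (volume.restrict (Ω : Set (Space n))))
    (hz : ∀ i, MemLp (z i) (s i) (volume.restrict (Ω : Set (Space n))))
    (hz0 : MemLp (z 0) ∞ (volume.restrict (Ω : Set (Space n))))
    (hg : IsWeakDiv Ω z (weakDiv Ω z))
    (hgr : MemLp (weakDiv Ω z) r (volume.restrict (Ω : Set (Space n))))
    (hG : ∀ i : Fin m, IsWeakGradBlock Ω i.succ u (weakGradBlock Ω i.succ u))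
    (hGp : ∀ i : Fin m, MemLp (weakGradBlock Ω i.succ u) (p i.succ)
      (volume.restrict (Ω : Set (Space n))))
    {μ : VectorMeasure (Space n) (Block n 0)} (hμ : IsDistribGradBlock Ω 0 u μ) (φ : 𝓓(Ω, ℝ)) :
    |firstPairing Ω z u φ| ≤ (eLpNorm (z 0) ∞ (volume.restrict (Ω : Set (Space n)))).toReal *
      ∫ x, |φ x| ∂μ.variation := by
  have : IsFiniteMeasure μ.variation := ⟨hμ.radon.finite_variation⟩
  obtain ⟨η, hη⟩ := exists_contDiffBump_seq (Space n)
  have hlim := tendsto_integral_inner_gradBlock_mollify hup huq hz hg hgr hG hGp φ hη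
  change Filter.Tendsto _ _ (nhds (firstPairing Ω z u φ)) at hlim
  have hui : IntegrableOn u Ω :=
    (hup 0).integrable (ENNReal.HolderConjugate.one_le (p 0) (s 0))
  set C := eLpNorm (z 0) ∞ (volume.restrict (Ω : Set (Space n))) with hC
  have hCt : C ≠ ∞ := hz0.2.ne
  obtain ⟨M, hM⟩ := exists_norm_le φ
  have hφi : Integrable φ μ.variation :=
    Integrable.of_bound φ.continuous.aestronglyMeasurable M (Filter.Eventually.of_forall hM)
  have hφe : ∫⁻ x, ‖φ x‖ₑ ∂μ.variation ≠ ∞ := hφi.2.ne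
  have hφr : (∫⁻ x, ‖φ x‖ₑ ∂μ.variation).toReal = ∫ x, |φ x| ∂μ.variation :=
    (integral_norm_eq_lintegral_enorm hφi.1).symm
  have hbound : ∀ δ : ℝ, 0 < δ → |firstPairing Ω z u φ| ≤
      C.toReal * ((∫ x, |φ x| ∂μ.variation) + δ * μ.variation.real Set.univ) := fun δ hδ => by
    obtain ⟨ε, hε, hεφ⟩ := uniform_enorm_le_add φ hδ
    have hle : ‖firstPairing Ω z u φ‖ₑ ≤ C * ((∫⁻ x, ‖φ x‖ₑ ∂μ.variation) +
        ENNReal.ofReal δ * μ.variation Set.univ) := by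
      refine le_of_tendsto hlim.enorm ?_
      filter_upwards [eventually_closedBall_subset φ hη, hη.eventually_lt_const hε] with k hk hkε
      exact hμ.enorm_integral_mollify_le hui (z 0) φ hk
        fun x y hxy => hεφ x y (hxy.trans_lt hkε)
    have hfin : ENNReal.ofReal δ * μ.variation Set.univ ≠ ∞ :=
      ENNReal.mul_ne_top ENNReal.ofReal_ne_top (measure_ne_top _ _)
    have := ENNReal.toReal_mono (ENNReal.mul_ne_top hCt (ENNReal.add_ne_top.2 ⟨hφe, hfin⟩)) hle
    rwa [toReal_enorm, ENNReal.toReal_mul, ENNReal.toReal_add hφe hfin, ENNReal.toReal_mul,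
      ENNReal.toReal_ofReal hδ.le, hφr, Real.norm_eq_abs] at this
  have ht : Filter.Tendsto (fun δ : ℝ => C.toReal * ((∫ x, |φ x| ∂μ.variation) +
      δ * μ.variation.real Set.univ)) (nhdsWithin 0 (Set.Ioi 0))
      (nhds (C.toReal * ∫ x, |φ x| ∂μ.variation)) :=
    ((by fun_prop : Continuous fun δ : ℝ => C.toReal * ((∫ x, |φ x| ∂μ.variation) +
      δ * μ.variation.real Set.univ)).tendsto' 0 _ (by simp)).mono_left nhdsWithin_le_nhds
  exact ge_of_tendsto ht (Filter.eventually_of_mem self_mem_nhdsWithin hbound)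

/-! ### Measures that represent functionals -/

theorem isFiniteRadonOn_withDensityᵥ {μ : Measure (Space n)}
    (hμ : μ.restrict (Ω : Set (Space n)) = μ) {g : Space n → ℝ} (hg : Integrable g μ) :
    IsFiniteRadonOn Ω (μ.withDensityᵥ g) where
  concentrated := by
    ext B hB
    rw [VectorMeasure.restrict_apply _ Ω.isOpen.measurableSet hB, withDensityᵥ_apply hg hB,
      withDensityᵥ_apply hg (hB.inter Ω.isOpen.measurableSet), ← Measure.restrict_restrict hB, hμ]
  finite_variation := by
    rw [Measure.variation_withDensityᵥ hg]
    simpa using! hg.2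

theorem isRepresentedBy_withDensityᵥ {μ : Measure (Space n)}
    (hμ : μ.restrict (Ω : Set (Space n)) = μ) {g : Space n → ℝ} (hg : Integrable g μ)
    {T : 𝓓(Ω, ℝ) → ℝ} (hT : ∀ φ : 𝓓(Ω, ℝ), T φ = ∫ x, φ x * g x ∂μ) :
    IsRepresentedBy Ω T (μ.withDensityᵥ g) where
  radon := isFiniteRadonOn_withDensityᵥ hμ hg
  eq φ := by
    obtain ⟨M, hM⟩ := exists_norm_le φ
    rw [hT, integral_withDensityᵥ hg φ.continuous.measurable hM]

theorem IsFiniteRadonOn.integrable_testFunction {ν : SignedMeasure (Space n)}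
    (hν : IsFiniteRadonOn Ω ν) (φ : 𝓓(Ω, ℝ)) : ν.Integrable φ := by
  have : IsFiniteMeasure ν.variation := ⟨hν.finite_variation⟩
  obtain ⟨M, hM⟩ := exists_norm_le φ
  exact Integrable.of_bound φ.continuous.aestronglyMeasurable M (Filter.Eventually.of_forall hM)

theorem IsRepresentedBy.add {T T' : 𝓓(Ω, ℝ) → ℝ} {ν ν' : SignedMeasure (Space n)}
    (h : IsRepresentedBy Ω T ν) (h' : IsRepresentedBy Ω T' ν') :
    IsRepresentedBy Ω (fun φ => T φ + T' φ) (ν + ν') where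
  radon :=
    { concentrated := by
        rw [VectorMeasure.restrict_add, h.radon.concentrated, h'.radon.concentrated]
      finite_variation := (VectorMeasure.variation_add_le _).trans_lt <|
        ENNReal.add_lt_top.2 ⟨h.radon.finite_variation, h'.radon.finite_variation⟩ }
  eq φ := by
    rw [h.eq, h'.eq, VectorMeasure.integral_add_vectorMeasure
      (h.radon.integrable_testFunction φ) (h'.radon.integrable_testFunction φ)]

end Anzellotti

/-! ### The main theorem -/

theorem mainTheorem6 {m : ℕ} (n : Fin (m + 1) → ℕ)
    (Ω₁ : Opens (Anzellotti.Block n 0)) (Ω₂ : Opens (Anzellotti.Rest n))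
    (hΩ₁ : Bornology.IsBounded (Ω₁ : Set (Anzellotti.Block n 0)))
    (hΩ₂ : Bornology.IsBounded (Ω₂ : Set (Anzellotti.Rest n)))
    (Ω : Opens (Anzellotti.Space n)) (hΩ : Ω = Anzellotti.prodDomain Ω₁ Ω₂)
    (p : Fin (m + 1) → ℝ≥0∞) (hp_first : p 0 = 1) (hp_one_lt : ∀ i : Fin m, 1 < p i.succ)
    (hp_mono : Monotone p) (hp_top : ∀ i, p i ≠ ∞)
    (q : ℝ≥0∞) (hq : 1 ≤ q)
    (u : Anzellotti.Space n → ℝ) (hu : Anzellotti.MemAnisoBV Ω p u)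
    (huq : MemLp u (max (p (Fin.last m)) q) (volume.restrict (Ω : Set (Anzellotti.Space n))))
    (z : ∀ i, Anzellotti.Space n → Anzellotti.Block n i)
    (hz : Anzellotti.MemX Ω (fun i => ENNReal.conjExponent (p i)) (ENNReal.conjExponent q) z) :
    ∃ ν ν₁ : SignedMeasure (Anzellotti.Space n),
      Anzellotti.IsRepresentedBy Ω (Anzellotti.pairing Ω z u) ν ∧
      (∀ B : Set (Anzellotti.Space n), MeasurableSet B → B ⊆ Ω →
        ENNReal.ofReal |ν B| ≤
          eLpNorm (z 0) ∞ (volume.restrict (Ω : Set (Anzellotti.Space n))) *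
              (Anzellotti.distribGradBlock Ω 0 u).variation B +
            ∑ i : Fin m,
              eLpNorm (z i.succ) (ENNReal.conjExponent (p i.succ))
                  (volume.restrict (Ω : Set (Anzellotti.Space n))) *
                eLpNorm (Anzellotti.weakGradBlock Ω i.succ u) (p i.succ)
                  (volume.restrict (Ω : Set (Anzellotti.Space n)))) ∧
      Anzellotti.IsRepresentedBy Ω (Anzellotti.firstPairing Ω z u) ν₁ ∧
      (∀ B : Set (Anzellotti.Space n), MeasurableSet B → B ⊆ Ω →
        ENNReal.ofReal |ν₁ B| ≤
          eLpNorm (z 0) ∞ (volume.restrict (Ω : Set (Anzellotti.Space n))) *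
            (Anzellotti.distribGradBlock Ω 0 u).variation B) ∧
      VectorMeasure.AbsolutelyContinuous ν₁
        (Anzellotti.distribGradBlock Ω 0 u).ennrealVariation := by
  have hfinΩ : IsFiniteMeasure (volume.restrict (Ω : Set (Anzellotti.Space n))) := by
    refine ⟨?_⟩
    rw [Measure.restrict_apply_univ, hΩ]
    exact (Anzellotti.isBounded_prodDomain hΩ₁ hΩ₂).measure_lt_top
  have hp1 : ∀ i, 1 ≤ p i := Fin.cases hp_first.ge fun i => (hp_one_lt i).le
  have hsp : ∀ i, (ENNReal.conjExponent (p i)).HolderConjugate (p i) := fun i =>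
    (ENNReal.HolderConjugate.conjExponent (hp1 i)).symm
  have hrq : (ENNReal.conjExponent q).HolderConjugate q :=
    (ENNReal.HolderConjugate.conjExponent hq).symm
  -- On a set of finite measure the largest exponent controls all the others.
  have hup : ∀ i, MemLp u (p i) (volume.restrict (Ω : Set (Anzellotti.Space n))) := fun i =>
    huq.mono_exponent ((hp_mono (Fin.le_last i)).trans (le_max_left _ _))
  have hu_q : MemLp u q (volume.restrict (Ω : Set (Anzellotti.Space n))) :=
    huq.mono_exponent (le_max_right _ _)
  have hz0 : MemLp (z 0) ∞ (volume.restrict (Ω : Set (Anzellotti.Space n))) := by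
    have := hz.memLp 0
    simpa [hp_first, ENNReal.conjExponent] using this
  obtain ⟨g, hg, hgr⟩ := hz.div
  replace hgr := hgr.ae_eq (hg.ae_eq hg.weakDiv)
  replace hg := hg.weakDiv
  have hG : ∀ i : Fin m, Anzellotti.IsWeakGradBlock Ω i.succ u
      (Anzellotti.weakGradBlock Ω i.succ u) := fun i => by
    obtain ⟨G, hG, -⟩ := hu.rest i
    exact hG.weakGradBlock
  have hGp : ∀ i : Fin m, MemLp (Anzellotti.weakGradBlock Ω i.succ u) (p i.succ)
      (volume.restrict (Ω : Set (Anzellotti.Space n))) := fun i => by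
    obtain ⟨G, hG, hGp⟩ := hu.rest i
    exact hGp.ae_eq (hG.ae_eq hG.weakGradBlock)
  have hμ := Anzellotti.isDistribGradBlock_distribGradBlock hu.first
  set μ := Anzellotti.distribGradBlock Ω 0 u
  have hμfin : IsFiniteMeasure μ.variation := ⟨hμ.radon.finite_variation⟩
  have hμΩ : μ.variation.restrict (Ω : Set (Anzellotti.Space n)) = μ.variation := by
    rw [← VectorMeasure.variation_restrict Ω.isOpen.measurableSet, hμ.radon.concentrated]
  have hzG : ∀ i : Fin m, IntegrableOn
      (fun x => ⟪z i.succ x, Anzellotti.weakGradBlock Ω i.succ u x⟫) Ω := fun i =>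
    memLp_one_iff_integrable.1 ((innerSL ℝ).memLp_of_bilin 1 (hz.memLp i.succ) (hGp i))
  obtain ⟨T, hT⟩ := Anzellotti.exists_linearMap_eq_firstPairing (z := z) (u := u)
    (memLp_one_iff_integrable.1 (hgr.mul' hu_q))
    (fun i => memLp_one_iff_integrable.1 ((hz.memLp i).smul (hup i))) hzG
  -- The density of `(z₁, D_{x₁}u)` with respect to `|D_{x₁}u|`, with constant `‖z₁‖_∞`.
  obtain ⟨f, hf, hfT, hfB⟩ := exists_density_of_abs_le_integral (μ := μ.variation) T
    { toFun := fun φ => (φ : Anzellotti.Space n → ℝ)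
      map_add' := fun _ _ => rfl
      map_smul' := fun _ _ => rfl }
    (fun φ => by
      obtain ⟨M, hM⟩ := Anzellotti.exists_norm_le φ
      exact MemLp.of_bound φ.continuous.aestronglyMeasurable M (Filter.Eventually.of_forall hM))
    ENNReal.toReal_nonneg
    (fun φ => (hT φ).symm ▸ Anzellotti.abs_firstPairing_le hup hu_q hz.memLp hz0 hg hgr hG hGp hμ φ)
  have hν₁ : ∀ B : Set (Anzellotti.Space n), MeasurableSet B →
      ENNReal.ofReal |μ.variation.withDensityᵥ f B| ≤
        eLpNorm (z 0) ∞ (volume.restrict (Ω : Set (Anzellotti.Space n))) * μ.variation B :=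
    fun B hB => by
      rw [withDensityᵥ_apply hf hB]
      refine (ENNReal.ofReal_le_ofReal (hfB B hB)).trans_eq ?_
      rw [ENNReal.ofReal_mul ENNReal.toReal_nonneg, ENNReal.ofReal_toReal hz0.2.ne,
        ofReal_measureReal]
  have hrep₁ : Anzellotti.IsRepresentedBy Ω (Anzellotti.firstPairing Ω z u)
      (μ.variation.withDensityᵥ f) :=
    Anzellotti.isRepresentedBy_withDensityᵥ hμΩ hf fun φ => (hT φ).symm.trans (hfT φ)
  have hh : IntegrableOn
      (fun x => ∑ i : Fin m, ⟪z i.succ x, Anzellotti.weakGradBlock Ω i.succ u x⟫) Ω :=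
    integrable_finsetSum _ fun i _ => hzG i
  have hrep₂ := Anzellotti.isRepresentedBy_withDensityᵥ (Ω := Ω)
    (Measure.restrict_restrict_of_subset le_rfl) hh
    (T := fun φ => ∑ i : Fin m, ∫ x in Ω, φ x *
      ⟪z i.succ x, Anzellotti.weakGradBlock Ω i.succ u x⟫) fun φ => by
    simp_rw [Finset.mul_sum]
    exact (integral_finsetSum _ fun i _ => (φ.integrable_bilin (ContinuousLinearMap.mul ℝ ℝ)
      (hzG i).locallyIntegrableOn).integrableOn).symm
  -- `(z, Du)` is `(z₁, D_{x₁}u)` plus the absolutely continuous terms subtracted in its definition.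
  refine ⟨μ.variation.withDensityᵥ f +
    (volume.restrict (Ω : Set (Anzellotti.Space n))).withDensityᵥ fun x =>
      ∑ i : Fin m, ⟪z i.succ x, Anzellotti.weakGradBlock Ω i.succ u x⟫,
    μ.variation.withDensityᵥ f, ?_, fun B hB hBΩ => ?_, hrep₁, fun B hB _ => hν₁ B hB, fun B hB => ?_⟩
  · refine ⟨(hrep₁.add hrep₂).radon, fun φ => ?_⟩
    rw [← (hrep₁.add hrep₂).eq]
    exact (sub_add_cancel _ _).symm
  · rw [VectorMeasure.add_apply, withDensityᵥ_apply hh hB, Measure.restrict_restrict hB,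
      Set.inter_eq_left.2 hBΩ]
    refine (ENNReal.ofReal_le_ofReal (abs_add_le _ _)).trans ?_
    rw [ENNReal.ofReal_add (abs_nonneg _) (abs_nonneg _)]
    refine add_le_add (hν₁ B hB) ?_
    rw [integral_finsetSum _ fun i _ => (hzG i).mono_set hBΩ]
    rw [← Real.norm_eq_abs, ofReal_norm]
    refine (enorm_sum_le _ _).trans (Finset.sum_le_sum fun i _ => ?_)
    refine (enorm_integral_le_lintegral_enorm _).trans ((lintegral_mono_set hBΩ).trans ?_)
    rw [← eLpNorm_one_eq_lintegral_enorm]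
    refine (eLpNorm_le_eLpNorm_mul_eLpNorm_of_nnnorm (p := ENNReal.conjExponent (p i.succ))
      (q := p i.succ) (r := 1) (hz.memLp i.succ).1 (hGp i).1 (fun a b => ⟪a, b⟫) 1
      (Filter.Eventually.of_forall fun x => ?_)).trans_eq ?_
    · rw [one_mul]; exact nnnorm_inner_le_nnnorm _ _
    · rw [ENNReal.coe_one, one_mul]
  · by_cases hBm : MeasurableSet B
    · rw [VectorMeasure.ennrealVariation_apply _ hBm] at hB
      have := hν₁ B hBm
      rw [hB, mul_zero, nonpos_iff_eq_zero, ENNReal.ofReal_eq_zero] at this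
      exact abs_nonpos_iff.1 this
    -- Absolute continuity is tested on all sets, and a vector measure is zero on nonmeasurable ones
    -- by convention.
    · exact VectorMeasure.not_measurable _ hBm
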